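/- A hypergraph is a pair $(V,E)$ with $V$ a finite set of vertices and $E$ a set of subsets of $V$, called hyperedges; it is $n$-uniform if every hyperedge has exactly $n$ elements, the degree of a vertex is the number of hyperedges containing it, and the maximum degree is the largest degree of a vertex. In the Maker–Breaker game on a hypergraph, Maker and Breaker alternately claim a previously unclaimed vertex, with Maker going first, until all vertices are claimed; Maker wins if he has claimed all vertices of some hyperedge, and otherwise Breaker wins. Theorem 1.2. For every sufficiently large integer $n$ there is an $n$-uniform hypergraph with maximum degree $\left\lfloor \frac{2^{n-1}}{n} \right\rfloor$ on which Maker has a winning strategy. (If $n$ is a power of $2$, the maximum degree is exactly $\frac{2^{n-1}}{n}$.) -/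

import Mathlib

open scoped Hypergraph

namespace MakerBreaker

variable {α : Type*}

/-- Every hyperedge of `H` has exactly `n` vertices. -/
def IsUniform (H : Hypergraph α) (n : ℕ) : Prop :=
  ∀ e ∈ E(H), e.ncard = n

/-- The degree of a vertex: the number of hyperedges containing it. -/
noncomputable def degree (H : Hypergraph α) (v : α) : ℕ :=
  {e ∈ E(H) | v ∈ e}.ncard

/-- The maximum of the degrees of the vertices of `H` is (attained and equal to) `D`. -/
def HasMaxDegree (H : Hypergraph α) (D : ℕ) : Prop :=
  IsGreatest (degree H '' V(H)) D

/-- A strategy for Maker. A history of the game is the list of all vertices claimed so far (by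
either player), the most recently claimed vertex first. The strategy answers every history by a
vertex, which must be a previously unclaimed vertex of the board as long as there is one. -/
structure MakerStrategy (H : Hypergraph α) where
  /-- the vertex that Maker claims after the given history -/
  move : List α → α
  legal : ∀ h : List α, (∃ v ∈ V(H), v ∉ h) → move h ∈ V(H) ∧ move h ∉ h

/-- The histories that can arise when Maker moves first and follows the strategy `σ`, the two
players alternate, and Breaker claims arbitrary unclaimed vertices. -/
inductive IsPlay (H : Hypergraph α) (σ : MakerStrategy H) : List α → Prop
  | start : IsPlay H σ []
  | maker (h : List α) (hh : IsPlay H σ h) (turn : Even h.length)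
      (hfree : ∃ v ∈ V(H), v ∉ h) : IsPlay H σ (σ.move h :: h)
  | breaker (h : List α) (hh : IsPlay H σ h) (turn : Odd h.length)
      (w : α) (hw : w ∈ V(H)) (hfree : w ∉ h) : IsPlay H σ (w :: h)

/-- The vertices claimed by Maker in a history (most recent first): those claimed in the first,
third, fifth, ... move of the game. -/
def makerVertices : List α → Set α
  | [] => ∅
  | v :: h => {x | (Even h.length ∧ x = v) ∨ x ∈ makerVertices h}

/-- Maker has a winning strategy on `H`: a strategy such that in every game played according to it
until all vertices are claimed, Maker has claimed all vertices of some hyperedge. -/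
def MakerHasWinningStrategy (H : Hypergraph α) : Prop :=
  ∃ σ : MakerStrategy H, ∀ h : List α, IsPlay H σ h → (∀ v ∈ V(H), v ∈ h) →
    ∃ e ∈ E(H), e ⊆ makerVertices h

end MakerBreaker

/-! Maker opens at the root of a binary tree and answers each move with the sibling, and so ends up
owning a full branch (`exists_branch_subset`). If all leaves have depth at least `k = n - 1` and the
hyperedges are the last `n` nodes of the branches, Maker wins, and the degree of a node is its
number of leaf descendants within distance `k`. A disjoint sunflower makes the maximum degree
exactly `d = 2 ^ k / (k + 1)`.

It remains to find such a tree with at most `d` of these leaves below every node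
(`constructible_of_large`). A node is described by its leaf vector, the number of leaves allowed at
each depth up to `k`. Starting from `d` leaves at depth `k` and halving at every branching leads to
about `d / 2 ^ (j + 1)` leaves at depth `k - j`. Each depth has Kraft weight about `d / 2 ^ (k +
1)`, in total about 1/2, while Kraft's inequality needs 1.

Uneven sharing gains the missing factor. In each round, `q` of the 32 descendants at distance 5 take
the shallowest third of the leaves and are completed by `Constructible.of_kraft`; the other `32 - q`
divide the rest, get more than an even share, and go on halving. Hence `q` can grow from round to
round until it reaches 32. -/

namespace MakerBreaker

/-! ### The pairing strategy. -/

section Pairing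

variable {α : Type*}

lemma makerVertices_cons_of_even {h : List α} (hh : Even h.length) (v : α) :
    makerVertices (v :: h) = insert v (makerVertices h) := by
  ext x; simp [makerVertices, hh]

lemma makerVertices_cons_of_odd {h : List α} (hh : Odd h.length) (v : α) :
    makerVertices (v :: h) = makerVertices h := by
  ext x; simp [makerVertices, hh]

lemma IsPlay.mem_vertexSet {H : Hypergraph α} {σ : MakerStrategy H} {h : List α}
    (hp : IsPlay H σ h) : ∀ v ∈ h, v ∈ V(H) := by
  induction hp with
  | start => simp
  | maker h _ _ hfree ih =>
    intro v hv
    rcases List.mem_cons.1 hv with rfl | hv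
    · exact (σ.legal h hfree).1
    · exact ih v hv
  | breaker h _ _ w hw _ ih =>
    intro v hv
    rcases List.mem_cons.1 hv with rfl | hv
    · exact hw
    · exact ih v hv

open Classical in
/-- Some unclaimed vertex, if there is one. -/
noncomputable def freeVertex (H : Hypergraph α) (r : α) (h : List α) : α :=
  if hf : ∃ v ∈ V(H), v ∉ h then hf.choose else r

open Classical in
/-- Maker opens with `r` and then answers each vertex with its partner, when possible. -/
noncomputable def pairingMove (H : Hypergraph α) (r : α) (partner : α → α) : List α → α
  | [] => r
  | w :: t => if partner w ∈ V(H) ∧ partner w ∉ w :: t then partner w else freeVertex H r (w :: t)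

lemma freeVertex_legal (H : Hypergraph α) (r : α) (h : List α) (hf : ∃ v ∈ V(H), v ∉ h) :
    freeVertex H r h ∈ V(H) ∧ freeVertex H r h ∉ h := by
  rw [freeVertex, dif_pos hf]
  exact hf.choose_spec

/-- The pairing strategy with opening move `r`. -/
noncomputable def pairingStrategy (H : Hypergraph α) (r : α) (hr : r ∈ V(H)) (partner : α → α) :
    MakerStrategy H where
  move := pairingMove H r partner
  legal h hf := by
    cases h with
    | nil => simpa [pairingMove] using hr
    | cons w t =>
      rw [pairingMove]
      split_ifs with hc
      · exact hc
      · exact freeVertex_legal H r _ hf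

/-- Maker owns `r` and a member of each pair touched so far. -/
def PairsSecured (H : Hypergraph α) (r : α) (partner : α → α) (h : List α) : Prop :=
  r ∈ makerVertices h ∧ ∀ v ∈ h, partner v ∈ V(H) → partner v ≠ v →
    v ∈ makerVertices h ∨ partner v ∈ makerVertices h

/-- The invariant holds only just after Maker's moves; when Breaker has moved last, it is kept for
the history before that move. -/
lemma pairsSecured_of_isPlay {H : Hypergraph α} {r : α} {hr : r ∈ V(H)} {partner : α → α}
    (hinv : Function.Involutive partner) {h : List α}
    (hp : IsPlay H (pairingStrategy H r hr partner) h) :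
    (Odd h.length → PairsSecured H r partner h) ∧
      (Even h.length → h = [] ∨ ∃ w t, h = w :: t ∧ PairsSecured H r partner t) := by
  induction hp with
  | start => simp
  | breaker h _ turn w _ _ ih =>
    refine ⟨fun ho => ?_, fun _ => Or.inr ⟨w, h, rfl, ih.1 turn⟩⟩
    rw [List.length_cons, Nat.odd_add_one] at ho
    exact absurd turn ho
  | maker h hh turn hfree ih =>
    refine ⟨fun _ => ?_, fun he => ?_⟩
    swap
    · rw [List.length_cons, Nat.even_add_one] at he
      exact absurd turn he
    have hM := makerVertices_cons_of_even turn ((pairingStrategy H r hr partner).move h)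
    rcases ih.2 turn with rfl | ⟨w, t, rfl, hr', hsec⟩
    · refine ⟨by rw [hM]; exact Or.inl rfl, fun v hv _ _ => Or.inl ?_⟩
      rw [hM]
      simp only [List.mem_singleton] at hv
      exact Or.inl hv
    · have ht : Odd t.length := by
        rw [List.length_cons, Nat.even_add_one, Nat.not_even_iff_odd] at turn
        exact turn
      rw [makerVertices_cons_of_odd ht] at hM
      refine ⟨by rw [hM]; exact Or.inr hr', fun v hv hpv hne => ?_⟩
      rw [hM]
      rcases List.mem_cons.1 hv with rfl | hv
      · exact Or.inl (Or.inl rfl)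
      rcases List.mem_cons.1 hv with rfl | hv
      · by_cases hc : partner v ∈ v :: t
        · have hc' : partner v ∈ t := (List.mem_cons.1 hc).resolve_left hne
          -- The partner was claimed before `v`, so the pair was already secured, and it must be
          -- Maker who holds the partner.
          have := hsec _ hc' (by rw [hinv v]; exact hh.mem_vertexSet v (by simp))
            (by rw [hinv v]; exact hne.symm)
          rw [hinv v] at this
          exact this.symm.imp Or.inr Or.inr
        · refine Or.inr (Or.inl ?_)
          change _ = pairingMove H r partner (v :: t)
          rw [pairingMove, if_pos ⟨hpv, hc⟩]
      · exact (hsec v hv hpv hne).imp Or.inr Or.inr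

/-- If every set that contains `r` and meets all pairs `{v, partner v}` of distinct vertices
contains an edge, then Maker wins. -/
theorem makerHasWinningStrategy_of_pairing (H : Hypergraph α) (r : α) (hr : r ∈ V(H))
    (partner : α → α) (hinv : Function.Involutive partner)
    (hwin : ∀ M : Set α, r ∈ M → (∀ v ∈ V(H), partner v ∈ V(H) → partner v ≠ v →
      v ∈ M ∨ partner v ∈ M) → ∃ e ∈ E(H), e ⊆ M) :
    MakerHasWinningStrategy H := by
  refine ⟨pairingStrategy H r hr partner, fun h hp hfull => ?_⟩
  obtain ⟨hodd, heven⟩ := pairsSecured_of_isPlay hinv hp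
  rcases Nat.even_or_odd h.length with he | ho
  · rcases heven he with rfl | ⟨w, t, rfl, hr', hsec⟩
    · exact absurd (hfull r hr) (by simp)
    · have ht : Odd t.length := by
        rw [List.length_cons, Nat.even_add_one, Nat.not_even_iff_odd] at he
        exact he
      rw [makerVertices_cons_of_odd ht]
      refine hwin _ hr' fun v hv hpv hne => ?_
      rcases List.mem_cons.1 (hfull v hv) with rfl | hvt
      · have hc : partner v ∈ t := (List.mem_cons.1 (hfull _ hpv)).resolve_left hne
        have := hsec _ hc (by rw [hinv v]; exact hv) (by rw [hinv v]; exact hne.symm)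
        rw [hinv v] at this
        exact this.symm
      · exact hsec v hvt hpv hne
  · exact hwin _ (hodd ho).1 fun v hv => (hodd ho).2 v (hfull v hv)

end Pairing

/-! ### Trees, leaf vectors and Kraft's inequality. -/

section

/-- Binary trees in which every inner node has exactly two children. -/
inductive BranchTree : Type
  | leaf : BranchTree
  | node : BranchTree → BranchTree → BranchTree

namespace BranchTree

/-- The number of leaves at depth `i`. -/
def leafCount : BranchTree → ℕ → ℕ
  | leaf, 0 => 1
  | leaf, _ + 1 => 0
  | node _ _, 0 => 0
  | node l r, i + 1 => l.leafCount i + r.leafCount i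

/-- Every node has at most `d` leaf descendants within distance `k`. -/
def Bounded (k d : ℕ) : BranchTree → Prop
  | leaf => 1 ≤ d
  | node l r => l.Bounded k d ∧ r.Bounded k d ∧
      ∑ i ∈ Finset.range (k + 1), (node l r).leafCount i ≤ d

end BranchTree

open BranchTree

/-- Some `d`-bounded tree has at most `x i` leaves at depth `i` for each `i ≤ k`. -/
def Constructible (k d : ℕ) (x : ℕ → ℕ) : Prop :=
  ∃ t : BranchTree, t.Bounded k d ∧ ∀ i ≤ k, t.leafCount i ≤ x i

variable {k d : ℕ} {x y z : ℕ → ℕ}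

lemma Constructible.mono (hy : Constructible k d y) (h : ∀ i ≤ k, y i ≤ x i) :
    Constructible k d x := by
  obtain ⟨t, ht, hc⟩ := hy
  exact ⟨t, ht, fun i hi => (hc i hi).trans (h i hi)⟩

lemma Constructible.of_leaf (hd : 1 ≤ d) (h : 1 ≤ x 0) : Constructible k d x := by
  refine ⟨leaf, hd, fun i _ => ?_⟩
  cases i with
  | zero => exact h
  | succ i => exact Nat.zero_le _

/-- Leaves at depth `k` below a child are out of range of the parent, so `y k` and `z k` are not
charged to `x`. -/
lemma Constructible.branch (hy : Constructible k d y) (hz : Constructible k d z)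
    (h : ∀ i < k, y i + z i ≤ x (i + 1)) (hx : ∑ i ∈ Finset.range (k + 1), x i ≤ d) :
    Constructible k d x := by
  obtain ⟨t, ht, hct⟩ := hy
  obtain ⟨u, hu, hcu⟩ := hz
  have key : ∀ i ≤ k, (node t u).leafCount i ≤ x i := by
    intro i hi
    cases i with
    | zero => exact Nat.zero_le _
    | succ i =>
      exact (add_le_add (hct i (by lia)) (hcu i (by lia))).trans (h i (by lia))
  exact ⟨node t u, ⟨ht, hu, (Finset.sum_le_sum fun i hi => key i (by
    simp only [Finset.mem_range] at hi; lia)).trans hx⟩, key⟩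

/-- Filling greedily from the shallowest depth never overshoots, since each weight divides the
earlier ones and the target. -/
lemma exists_le_sum_eq (c : ℕ) (m : ℕ) (w : ℕ → ℕ)
    (h : c * 2 ^ m ≤ ∑ i ∈ Finset.range (m + 1), w i * 2 ^ (m - i)) :
    ∃ y : ℕ → ℕ, (∀ i, y i ≤ w i) ∧
      ∑ i ∈ Finset.range (m + 1), y i * 2 ^ (m - i) = c * 2 ^ m := by
  induction m with
  | zero => exact ⟨fun i => if i = 0 then c else 0, fun i => by
      dsimp only; split_ifs with hi
      · subst hi; simpa using h
      · exact Nat.zero_le _, by simp⟩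
  | succ m ih =>
    have hs : ∀ v : ℕ → ℕ, ∑ i ∈ Finset.range (m + 1 + 1), v i * 2 ^ (m + 1 - i) =
        2 * ∑ i ∈ Finset.range (m + 1), v i * 2 ^ (m - i) + v (m + 1) := by
      intro v
      rw [Finset.sum_range_succ, Finset.mul_sum]
      congr 1
      · refine Finset.sum_congr rfl fun i hi => ?_
        simp only [Finset.mem_range] at hi
        rw [show m + 1 - i = (m - i) + 1 by lia, pow_succ]; ring
      · simp
    rw [hs] at h
    by_cases hc : c * 2 ^ m ≤ ∑ i ∈ Finset.range (m + 1), w i * 2 ^ (m - i)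
    · obtain ⟨y, hy, hsum⟩ := ih hc
      refine ⟨fun i => if i = m + 1 then 0 else y i, fun i => ?_, ?_⟩
      · dsimp only; split_ifs
        · exact Nat.zero_le _
        · exact hy i
      · rw [hs, Finset.sum_congr rfl (g := fun i => y i * 2 ^ (m - i)), hsum]
        · simp; ring
        · intro i hi
          simp only [Finset.mem_range] at hi
          rw [if_neg (by lia)]
    · refine ⟨fun i => if i = m + 1 then
        c * 2 ^ (m + 1) - 2 * ∑ i ∈ Finset.range (m + 1), w i * 2 ^ (m - i) else w i,
        fun i => ?_, ?_⟩
      · dsimp only; split_ifs with hi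
        · subst hi; lia
        · exact le_rfl
      · rw [hs, Finset.sum_congr rfl (g := fun i => w i * 2 ^ (m - i))]
        · rw [if_pos rfl]
          rw [pow_succ] at *
          lia
        · intro i hi
          simp only [Finset.mem_range] at hi
          rw [if_neg (by lia)]

/-- Kraft's inequality. -/
lemma Constructible.of_kraft {m : ℕ} (hm : m ≤ k) (hx : ∑ i ∈ Finset.range (k + 1), x i ≤ d)
    (h : 2 ^ m ≤ ∑ i ∈ Finset.range (m + 1), x i * 2 ^ (m - i)) : Constructible k d x := by
  have hleaf : ∀ x : ℕ → ℕ, ∑ i ∈ Finset.range (k + 1), x i ≤ d → 1 ≤ x 0 →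
      Constructible k d x := by
    intro x hx h0
    refine .of_leaf ?_ h0
    have := Finset.single_le_sum (f := x) (fun i _ => Nat.zero_le _)
      (Finset.mem_range.2 (Nat.succ_pos k))
    lia
  induction m generalizing x with
  | zero => exact hleaf x hx (by simpa using h)
  | succ m ih =>
    by_cases h0 : 1 ≤ x 0
    · exact hleaf x hx h0
    have h0 : x 0 = 0 := by lia
    rw [Finset.sum_range_succ', h0] at h
    have h' : 2 * 2 ^ m ≤ ∑ i ∈ Finset.range (m + 1), x (i + 1) * 2 ^ (m - i) := by
      rw [pow_succ] at h
      simp only [Nat.add_sub_add_right, zero_mul, add_zero] at h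
      lia
    obtain ⟨y, hy, hsum⟩ := exists_le_sum_eq 1 m (fun i => x (i + 1)) (by lia)
    -- Entry `k` of a child is not controlled by `x`; setting it to zero keeps the total at most
    -- `d`, and the Kraft sum up to `m < k` does not see it.
    have hle : ∀ v : ℕ → ℕ, (∀ i, v i ≤ x (i + 1)) →
        ∑ i ∈ Finset.range (k + 1), (if i < k then v i else 0) ≤ d := by
      intro v hv
      rw [Finset.sum_range_succ, if_neg (lt_irrefl k), add_zero]
      rw [Finset.sum_range_succ', h0, add_zero] at hx
      refine (Finset.sum_le_sum fun i hi => ?_).trans hx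
      rw [if_pos (Finset.mem_range.1 hi)]
      exact hv i
    have hcut : ∀ v : ℕ → ℕ, ∑ i ∈ Finset.range (m + 1), (if i < k then v i else 0) * 2 ^ (m - i) =
        ∑ i ∈ Finset.range (m + 1), v i * 2 ^ (m - i) := by
      intro v
      refine Finset.sum_congr rfl fun i hi => ?_
      rw [if_pos (by have := Finset.mem_range.1 hi; lia)]
    refine .branch (ih (by lia) (hle y hy) ?_)
      (ih (by lia) (hle (fun i => x (i + 1) - y i) fun i => Nat.sub_le _ _) ?_) ?_ hx
    · rw [hcut, hsum]; lia
    · rw [hcut]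
      have : ∑ i ∈ Finset.range (m + 1), y i * 2 ^ (m - i) +
          ∑ i ∈ Finset.range (m + 1), (x (i + 1) - y i) * 2 ^ (m - i) =
          ∑ i ∈ Finset.range (m + 1), x (i + 1) * 2 ^ (m - i) := by
        rw [← Finset.sum_add_distrib]
        refine Finset.sum_congr rfl fun i _ => ?_
        rw [← add_mul, Nat.add_sub_cancel' (hy i)]
      lia
    · intro i hi
      have := hy i
      simp only [if_pos hi]
      lia

/-! ### Even and uneven sharing of leaves. -/

/-- The leaf vector passed to both children when a node shares its leaves equally among them. -/
def halve (k d : ℕ) (x : ℕ → ℕ) (i : ℕ) : ℕ :=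
  if i < k then x (i + 1) / 2 else d / 2

lemma sum_halve_le (hx : ∑ i ∈ Finset.range (k + 1), x i ≤ d) :
    ∑ i ∈ Finset.range (k + 1), halve k d x i ≤ d := by
  have h : ∑ i ∈ Finset.range k, halve k d x i * 2 ≤ ∑ i ∈ Finset.range k, x (i + 1) := by
    refine Finset.sum_le_sum fun i hi => ?_
    rw [halve, if_pos (Finset.mem_range.1 hi)]
    exact Nat.div_mul_le_self _ _
  rw [← Finset.sum_mul] at h
  rw [Finset.sum_range_succ'] at hx
  rw [Finset.sum_range_succ, show halve k d x k = d / 2 by simp [halve]]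
  lia

lemma Constructible.of_halve (h : Constructible k d (halve k d x))
    (hx : ∑ i ∈ Finset.range (k + 1), x i ≤ d) : Constructible k d x := by
  refine .branch h h (fun i hi => ?_) hx
  rw [halve, if_pos hi]
  lia

lemma sum_halve_iterate_le (hx : ∑ i ∈ Finset.range (k + 1), x i ≤ d) (m : ℕ) :
    ∑ i ∈ Finset.range (k + 1), (halve k d)^[m] x i ≤ d := by
  induction m with
  | zero => exact hx
  | succ m ih => rw [Function.iterate_succ_apply']; exact sum_halve_le ih

lemma Constructible.of_halve_iterate {m : ℕ} (h : Constructible k d ((halve k d)^[m] x))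
    (hx : ∑ i ∈ Finset.range (k + 1), x i ≤ d) : Constructible k d x := by
  induction m with
  | zero => exact h
  | succ m ih =>
    rw [Function.iterate_succ_apply'] at h
    exact ih (h.of_halve (sum_halve_iterate_le hx m))

/-- This entry came in at depth `k` as `d / 2` and has since been halved `j` times. -/
lemma halve_iterate_apply_of_lt (m j : ℕ) (hj : j < m) (hjk : j ≤ k) :
    (halve k d)^[m] x (k - j) = d / 2 ^ (j + 1) := by
  induction j generalizing m with
  | zero =>
    obtain ⟨m, rfl⟩ := Nat.exists_eq_add_one_of_ne_zero hj.ne'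
    rw [Function.iterate_succ_apply']
    simp [halve]
  | succ j ih =>
    obtain ⟨m, rfl⟩ := Nat.exists_eq_add_one_of_ne_zero (show m ≠ 0 by lia)
    rw [Function.iterate_succ_apply', halve, if_pos (by lia),
      show k - (j + 1) + 1 = k - j by lia, ih m (by lia) (by lia), Nat.div_div_eq_div_mul,
      ← pow_succ]

lemma halve_iterate_apply_of_le (m i : ℕ) (h : i + m ≤ k) :
    (halve k d)^[m] x i = x (i + m) / 2 ^ m := by
  induction m generalizing i with
  | zero => simp
  | succ m ih =>
    rw [Function.iterate_succ_apply', halve, if_pos (by lia), ih (i + 1) (by lia),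
      Nat.div_div_eq_div_mul, ← pow_succ]
    congr 2; lia

/-- Distributing the leaves over the `2 ^ R` descendants at distance `R`, `a` of which receive `u`
and the others `s`. -/
lemma Constructible.of_split {u s : ℕ → ℕ} {R a : ℕ} (ha : a ≤ 2 ^ R)
    (hu : Constructible k d u) (hs : a < 2 ^ R → Constructible k d s)
    (husupp : ∀ i, k < i + R → u i = 0) (hssupp : ∀ i, k < i + R → s i = 0)
    (h : ∀ i, i + R ≤ k → a * u i + (2 ^ R - a) * s i ≤ x (i + R))
    (hx : ∑ i ∈ Finset.range (k + 1), x i ≤ d) : Constructible k d x := by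
  induction R generalizing a x with
  | zero =>
    have h' : ∀ i ≤ k, a * u i + (1 - a) * s i ≤ x i := by simpa using h
    rcases (show a = 0 ∨ a = 1 by simp at ha; lia) with rfl | rfl
    · exact (hs (by simp)).mono fun i hi => by simpa using h' i hi
    · exact hu.mono fun i hi => by simpa using h' i hi
  | succ R ih =>
    have hpow : 2 ^ (R + 1) = 2 * 2 ^ R := by rw [pow_succ]; ring
    have hchild : ∀ b c : ℕ, a = b + c → b ≤ 2 ^ R → c ≤ 2 ^ R →
        Constructible k d (fun i => if R ≤ i ∧ i < k then
          b * u (i - R) + (2 ^ R - b) * s (i - R) else 0) := by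
      intro b c hbc hb hc
      refine ih hb (fun hlt => hs (by lia)) (fun i hi => husupp i (by lia))
        (fun i hi => hssupp i (by lia)) (fun i hi => ?_) ?_
      · by_cases hik : i + R < k
        · rw [if_pos ⟨by lia, hik⟩, Nat.add_sub_cancel]
        · rw [husupp i (by lia), hssupp i (by lia)]; simp
      · rw [Finset.sum_range_succ, if_neg (by lia), add_zero]
        rw [Finset.sum_range_succ'] at hx
        refine le_trans (Finset.sum_le_sum fun i hi => ?_) (le_self_add.trans hx)
        split_ifs with hc
        · have := h (i - R) (by lia)
          rw [show i - R + (R + 1) = i + 1 by lia] at this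
          refine le_trans (add_le_add ?_ ?_) this <;> refine Nat.mul_le_mul_right _ (by lia)
        · exact Nat.zero_le _
    -- The recipients of `u` are divided evenly between the children, so neither side exceeds `2 ^
    -- R`.
    refine .branch (hchild (a / 2) (a - a / 2) (by lia) (by lia) (by lia))
      (hchild (a - a / 2) (a / 2) (by lia) (by lia) (by lia)) (fun i hi => ?_) hx
    by_cases hRi : R ≤ i
    · rw [if_pos ⟨hRi, hi⟩, if_pos ⟨hRi, hi⟩]
      have := h (i - R) (by lia)
      rw [show i - R + (R + 1) = i + 1 by lia] at this
      refine le_trans (le_of_eq ?_) this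
      have e1 : a = a / 2 + (a - a / 2) := by lia
      have e2 : 2 ^ (R + 1) - a = (2 ^ R - a / 2) + (2 ^ R - (a - a / 2)) := by lia
      have e3 : a * u (i - R) = (a / 2 + (a - a / 2)) * u (i - R) := by rw [← e1]
      rw [e2, e3]
      ring
    · rw [if_neg (by lia), if_neg (by lia)]; exact Nat.zero_le _

end

/-! ### Rounds of uneven sharing. -/

section

variable {k d l D₁ D₂ : ℕ} {x : ℕ → ℕ}

lemma sum_shift_le {R : ℕ} {v : ℕ → ℕ} (hv : ∀ i, v i ≤ if i + R ≤ k then x (i + R) else 0) :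
    ∑ i ∈ Finset.range (k + 1), v i ≤ ∑ i ∈ Finset.range (k + 1), x i := by
  let w : ℕ → ℕ := fun i => if i ≤ k then x i else 0
  calc ∑ i ∈ Finset.range (k + 1), v i ≤ ∑ i ∈ Finset.range (k + 1), w (R + i) :=
        Finset.sum_le_sum fun i _ => by rw [add_comm]; exact hv i
    _ ≤ ∑ i ∈ Finset.range (R + (k + 1)), w i := by
        rw [Finset.sum_range_add w R]; exact Nat.le_add_left _ _
    _ = ∑ i ∈ Finset.range (k + 1), w i := by
        rw [add_comm, Finset.sum_range_add w (k + 1), Nat.add_eq_left]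
        exact Finset.sum_eq_zero fun i _ => if_neg (by lia)
    _ = ∑ i ∈ Finset.range (k + 1), x i :=
        Finset.sum_congr rfl fun i hi => if_pos (by have := Finset.mem_range.1 hi; lia)

/-- A leaf vector of total at most `d` which is at least as large as that of a node that
`l + 5` and `2 * (l + 5)` levels ago kept only a fraction `32 / D₁` and `32 / D₂` of an even share
of the leaves present then. -/
structure IsRich (k d l D₁ D₂ : ℕ) (x : ℕ → ℕ) : Prop where
  sum_le : ∑ i ∈ Finset.range (k + 1), x i ≤ d
  recent : ∀ j < l, d / 2 ^ (j + 1) ≤ x (k - j)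
  middle : ∀ j < l, d / (2 ^ (j + l + 1) * D₁) ≤ x (k - (j + (l + 5)))
  old : ∀ j < l, d / (2 ^ (j + 2 * l + 1) * (D₁ * D₂)) ≤ x (k - (j + 2 * (l + 5)))

/-- Each of the `l` old entries contributes about `2 ^ 14 * d / C` with `C = q * D₁ * D₂`. Rounding
down costs at most `2 ^ (3 * l + 15) ≤ 2 ^ k / 2 ^ 10` in total, which the slack between `hd` and
`hqD` absorbs. -/
lemma kraft_sum_of_isRich {q : ℕ} (hk : 3 * (l + 5) + 10 ≤ k)
    (hd : 67 * 2 ^ k ≤ 202 * (l * d)) (hq : 0 < q) (h₁ : 0 < D₁) (h₂ : 0 < D₂)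
    (hqD : 303 * (q * (D₁ * D₂)) ≤ 50 * 2 ^ 15) (h : IsRich k d l D₁ D₂ x) {u : ℕ → ℕ}
    (hu : ∀ i, i + 5 + 2 * (l + 5) ≤ k → u i = x (i + 5) / q) :
    2 ^ k ≤ ∑ i ∈ Finset.range (k + 1), u i * 2 ^ (k - i) := by
  set C := q * (D₁ * D₂) with hC
  have hC0 : 0 < C := by positivity
  have hsum : ∑ j ∈ Finset.range l, d / (2 ^ (j + 2 * l + 1) * C) * 2 ^ (j + 2 * l + 15) ≤
      ∑ i ∈ Finset.range (k + 1), u i * 2 ^ (k - i) := by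
    calc _ ≤ ∑ j ∈ Finset.range l,
          u (k - (j + 2 * (l + 5)) - 5) * 2 ^ (k - (k - (j + 2 * (l + 5)) - 5)) := by
          refine Finset.sum_le_sum fun j hj => ?_
          have hj := Finset.mem_range.1 hj
          rw [show k - (k - (j + 2 * (l + 5)) - 5) = j + 2 * l + 15 by lia, hu _ (by lia),
            show k - (j + 2 * (l + 5)) - 5 + 5 = k - (j + 2 * (l + 5)) by lia]
          refine Nat.mul_le_mul_right _ ?_
          calc _ = d / (2 ^ (j + 2 * l + 1) * (D₁ * D₂)) / q := by
                rw [Nat.div_div_eq_div_mul, hC]; congr 1; ring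
            _ ≤ _ := Nat.div_le_div_right (h.old j hj)
      _ = ∑ i ∈ (Finset.range l).image (fun j => k - (j + 2 * (l + 5)) - 5),
          u i * 2 ^ (k - i) := by
          rw [Finset.sum_image]
          intro a ha b hb hab
          simp only [Finset.coe_range, Set.mem_Iio] at ha hb
          dsimp only at hab
          lia
      _ ≤ _ := by
          refine Finset.sum_le_sum_of_subset fun i hi => ?_
          obtain ⟨j, hj, rfl⟩ := Finset.mem_image.1 hi
          exact Finset.mem_range.2 (by lia)
  have hgeom : ∑ j ∈ Finset.range l, 2 ^ (j + 2 * l + 15) ≤ 2 ^ (3 * l + 15) := by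
    have e : ∀ j, 2 ^ (j + 2 * l + 15) = 2 ^ j * 2 ^ (2 * l + 15) := fun j => by
      rw [← pow_add, add_assoc]
    rw [Finset.sum_congr rfl fun j _ => e j, ← Finset.sum_mul,
      show 3 * l + 15 = l + (2 * l + 15) by ring, pow_add 2 l]
    refine Nat.mul_le_mul_right _ ?_
    have := Nat.geomSum_lt (m := 2) (n := l) (s := Finset.range l) le_rfl
      (fun i hi => Finset.mem_range.1 hi)
    exact this.le
  have hterm : l * (2 ^ 14 * d) ≤
      C * (∑ j ∈ Finset.range l, d / (2 ^ (j + 2 * l + 1) * C) * 2 ^ (j + 2 * l + 15)) +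
        C * ∑ j ∈ Finset.range l, 2 ^ (j + 2 * l + 15) := by
    rw [← mul_add, ← Finset.sum_add_distrib, Finset.mul_sum]
    refine le_trans (le_of_eq ?_) (Finset.sum_le_sum (f := fun _ => 2 ^ 14 * d) fun j _ => ?_)
    · simp
    · have := Nat.lt_mul_div_succ d (b := 2 ^ (j + 2 * l + 1) * C) (by positivity)
      have e : 2 ^ (j + 2 * l + 15) = 2 ^ 14 * 2 ^ (j + 2 * l + 1) := by
        rw [← pow_add]; congr 1; ring
      rw [e]
      calc 2 ^ 14 * d ≤ 2 ^ 14 * (2 ^ (j + 2 * l + 1) * C *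
            (d / (2 ^ (j + 2 * l + 1) * C) + 1)) := Nat.mul_le_mul_left _ this.le
        _ = _ := by ring
  have hpow : 2 ^ 10 * 2 ^ (3 * l + 15) ≤ 2 ^ k := by
    rw [← pow_add]; exact Nat.pow_le_pow_right (by norm_num) (by lia)
  refine le_trans ?_ hsum
  refine Nat.le_of_mul_le_mul_left (c := C) ?_ hC0
  have a1 : C * (∑ j ∈ Finset.range l, 2 ^ (j + 2 * l + 15)) ≤ C * 2 ^ (3 * l + 15) :=
    Nat.mul_le_mul_left _ hgeom
  have a2 : C * (2 ^ 10 * 2 ^ (3 * l + 15)) ≤ C * 2 ^ k := Nat.mul_le_mul_left _ hpow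
  have a3 : 303 * C * 2 ^ k ≤ 50 * 2 ^ 15 * 2 ^ k := Nat.mul_le_mul_right _ hqD
  generalize (∑ j ∈ Finset.range l, d / (2 ^ (j + 2 * l + 1) * C) * 2 ^ (j + 2 * l + 15)) = S at *
  generalize (∑ j ∈ Finset.range l, 2 ^ (j + 2 * l + 15)) = G at *
  generalize 2 ^ (3 * l + 15) = P at *
  generalize 2 ^ k = K at *
  nlinarith

lemma IsRich.constructible_of_split {q : ℕ} (hl : 0 < l) (hk : 3 * (l + 5) + 10 ≤ k)
    (hd : 67 * 2 ^ k ≤ 202 * (l * d)) (hq : 0 < q) (hq' : q ≤ 32) (h₁ : 0 < D₁) (h₂ : 0 < D₂)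
    (hqD : 303 * (q * (D₁ * D₂)) ≤ 50 * 2 ^ 15)
    (hnext : q < 32 → ∀ y, IsRich k d l (32 - q) D₁ y → Constructible k d y)
    (h : IsRich k d l D₁ D₂ x) : Constructible k d x := by
  -- The old block goes to `u`, everything deeper to `s`. The five levels of the split add no new
  -- leaves, so a round has period `l + 5`.
  set u : ℕ → ℕ := fun i => if i + 5 + 2 * (l + 5) ≤ k then x (i + 5) / q else 0 with hu
  set s : ℕ → ℕ := fun i => if i + 5 ≤ k ∧ k < i + 5 + 2 * (l + 5) then x (i + 5) / (32 - q) else 0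
    with hs
  have husum : ∑ i ∈ Finset.range (k + 1), u i ≤ d := by
    refine (sum_shift_le (R := 5) fun i => ?_).trans h.sum_le
    simp only [hu]
    split_ifs
    · exact Nat.div_le_self _ _
    · lia
    · exact Nat.zero_le _
    · exact le_rfl
  have hssum : ∑ i ∈ Finset.range (k + 1), s i ≤ d := by
    refine (sum_shift_le (R := 5) fun i => ?_).trans h.sum_le
    simp only [hs]
    split_ifs
    · exact Nat.div_le_self _ _
    · lia
    · exact Nat.zero_le _
    · exact le_rfl
  have hsval : ∀ j, j < 2 * (l + 5) → s (k - j - 5) = x (k - j) / (32 - q) := by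
    intro j hj
    simp only [hs]
    rw [if_pos (by lia), show k - j - 5 + 5 = k - j by lia]
  refine .of_split (R := 5) (a := q) (u := u) (s := s) (by simpa using hq')
    (.of_kraft le_rfl husum (kraft_sum_of_isRich hk hd hq h₁ h₂ hqD h fun i hi => if_pos hi))
    (fun hlt => ?_) (fun i hi => if_neg (by lia)) (fun i hi => if_neg (by lia)) (fun i hi => ?_)
    h.sum_le
  -- The `l` halvings create a new recent block; the former recent and middle blocks become middle
  -- and old, each with an extra divisor `32 - q`.
  · refine .of_halve_iterate (m := l) (hnext (by simpa using hlt) _ ⟨sum_halve_iterate_le hssum l,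
      fun j hj => (halve_iterate_apply_of_lt l j hj (by lia)).ge, fun j hj => ?_, fun j hj => ?_⟩)
      hssum
    · rw [halve_iterate_apply_of_le _ _ (by lia),
        show k - (j + (l + 5)) + l = k - j - 5 by lia, hsval j (by lia), Nat.div_div_eq_div_mul]
      refine le_trans (le_of_eq ?_) (Nat.div_le_div_right (h.recent j hj))
      rw [Nat.div_div_eq_div_mul]; congr 1; ring
    · rw [halve_iterate_apply_of_le _ _ (by lia),
        show k - (j + 2 * (l + 5)) + l = k - (j + (l + 5)) - 5 by lia, hsval _ (by lia),
        Nat.div_div_eq_div_mul]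
      refine le_trans (le_of_eq ?_) (Nat.div_le_div_right (h.middle j hj))
      rw [Nat.div_div_eq_div_mul]; congr 1; ring
  · simp only [hu, hs]
    by_cases hc : i + 5 + 2 * (l + 5) ≤ k
    · rw [if_pos hc, if_neg (by lia)]
      simpa using Nat.mul_div_le _ _
    · rw [if_neg hc, if_pos (by lia)]
      simpa using Nat.mul_div_le _ _

/-- A list of numbers of descendants, out of `32`, that can be saturated in successive rounds until
in the last round all of them are. -/
def IsSchedule : List ℕ → ℕ → ℕ → Prop
  | [], _, _ => False
  | q :: t, D₁, D₂ => 0 < q ∧ q ≤ 32 ∧ 303 * (q * (D₁ * D₂)) ≤ 50 * 2 ^ 15 ∧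
      (q = 32 ∨ IsSchedule t (32 - q) D₁)

lemma IsRich.constructible_of_isSchedule (hl : 0 < l) (hk : 3 * (l + 5) + 10 ≤ k)
    (hd : 67 * 2 ^ k ≤ 202 * (l * d)) (t : List ℕ) (h₁ : 0 < D₁) (h₂ : 0 < D₂)
    (ht : IsSchedule t D₁ D₂) (h : IsRich k d l D₁ D₂ x) : Constructible k d x := by
  induction t generalizing D₁ D₂ x with
  | nil => exact ht.elim
  | cons q t ih =>
    obtain ⟨hq, hq', hqD, hrest⟩ := ht
    exact h.constructible_of_split hl hk hd hq hq' h₁ h₂ hqD fun hlt y hy =>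
      ih (by lia) h₁ (hrest.resolve_left hlt.ne) hy

/-- Each `q` is the largest that the bound permits. In proportions of 32 the bound reads `a * b * c
≤ 50 / 303`, with `b`, `c` left over from the two preceding rounds. As `a * (1 - a) ^ 2 ≤ 4 / 27 <
50 / 303`, no constant proportion is tight, which leaves room for growth. -/
lemma isSchedule_32_32 :
    IsSchedule [5, 6, 7, 8, 9, 9, 10, 10, 11, 11, 12, 12, 13, 14, 15, 17, 21, 32] 32 32 := by
  norm_num [IsSchedule]

lemma constructible_single (hl : 0 < l) (hk : 3 * (l + 5) + 10 ≤ k)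
    (hd : 67 * 2 ^ k ≤ 202 * (l * d)) : Constructible k d (fun i => if i = k then d else 0) := by
  have hsum : ∑ i ∈ Finset.range (k + 1), (if i = k then d else 0) ≤ d := by simp
  refine .of_halve_iterate (m := 3 * (l + 5)) (IsRich.constructible_of_isSchedule hl hk hd _
    (D₁ := 32) (D₂ := 32) (by norm_num) (by norm_num) isSchedule_32_32
    ⟨sum_halve_iterate_le hsum _, fun j hj => ?_, fun j hj => ?_, fun j hj => ?_⟩) hsum
  · exact (halve_iterate_apply_of_lt _ j (by lia) (by lia)).ge
  · rw [halve_iterate_apply_of_lt _ _ (by lia) (by lia)]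
    exact le_of_eq (congrArg _ (by ring))
  · rw [halve_iterate_apply_of_lt _ _ (by lia) (by lia)]
    exact le_of_eq (congrArg _ (by ring))

lemma mul_self_le_two_pow {n : ℕ} (hn : 4 ≤ n) : n * n ≤ 2 ^ n := by
  induction n, hn using Nat.le_induction with
  | base => norm_num
  | succ n hn ih => rw [pow_succ]; nlinarith

theorem constructible_of_large (hk : 6000 ≤ k) :
    Constructible k (2 ^ k / (k + 1)) (fun i => if i = k then 2 ^ k / (k + 1) else 0) := by
  -- This is the largest `l` with `3 * (l + 5) + 10 ≤ k`; the ratio `l * d / 2 ^ k` tends to 1/3,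
  -- slightly above 67/202.
  refine constructible_single (l := (k - 25) / 3) (by lia) (by lia) ?_
  set d := 2 ^ k / (k + 1) with hd
  set l := (k - 25) / 3 with hl
  have h1 : 2 ^ k ≤ (k + 1) * d + k := by
    have := Nat.div_add_mod (2 ^ k) (k + 1)
    have := Nat.mod_lt (2 ^ k) (Nat.succ_pos k)
    lia
  have h2 : k ≤ 3 * l + 27 := by lia
  have h3 : k * k ≤ 2 ^ k := mul_self_le_two_pow (by lia)
  have h4 : 3 * l ≤ k := by lia
  clear_value d l
  clear hd hl
  generalize 2 ^ k = K at *
  have e1 : 606 * (l * K) ≤ 606 * (l * ((k + 1) * d + k)) := by gcongr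
  have e2 : 202 * (k * K) ≤ 202 * ((3 * l + 27) * K) := by gcongr
  have e3 : 202 * (3 * l * k) ≤ 202 * (k * k) := by gcongr
  have e4 : 6000 * K ≤ k * K := by gcongr
  have : (3 * (k + 1)) * (67 * K) ≤ (3 * (k + 1)) * (202 * (l * d)) := by nlinarith
  exact Nat.le_of_mul_le_mul_left this (by lia)

end

/-! ### Leaf addresses and branches. -/

namespace BranchTree

/-- The addresses of the leaves: the sequences of turns leading from the root to them. -/
def leaves : BranchTree → Finset (List Bool)
  | leaf => {[]}
  | node l r => l.leaves.image (List.cons false) ∪ r.leaves.image (List.cons true)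

/-- The addresses of the nodes. -/
def nodes (t : BranchTree) : Set (List Bool) :=
  {p | ∃ q ∈ t.leaves, p <+: q}

lemma mem_leaves_node {l r : BranchTree} {q : List Bool} :
    q ∈ (node l r).leaves ↔ ∃ b, ∃ q' ∈ (cond b r l).leaves, q = b :: q' := by
  simp [leaves, eq_comm]

lemma cons_mem_leaves_node {l r : BranchTree} {b : Bool} {q : List Bool} :
    b :: q ∈ (node l r).leaves ↔ q ∈ (cond b r l).leaves := by
  simp [mem_leaves_node]

lemma cons_mem_nodes_node {l r : BranchTree} {b : Bool} {p : List Bool}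
    (hp : p ∈ (cond b r l).nodes) : b :: p ∈ (node l r).nodes := by
  obtain ⟨q, hq, hpq⟩ := hp
  exact ⟨b :: q, cons_mem_leaves_node.2 hq, by simpa using hpq⟩

lemma nil_mem_nodes (t : BranchTree) : [] ∈ t.nodes := by
  suffices h : t.leaves.Nonempty by
    obtain ⟨q, hq⟩ := h
    exact ⟨q, hq, List.nil_prefix⟩
  induction t with
  | leaf => simp [leaves]
  | node l r ihl ihr => simp [leaves, ihl]

lemma finite_nodes (t : BranchTree) : t.nodes.Finite := by
  refine (t.leaves.finite_toSet.biUnion fun q _ => q.inits.finite_toSet).subset ?_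
  rintro p ⟨q, hq, hpq⟩
  simpa using ⟨q, hq, hpq⟩

lemma card_leaves_of_length (t : BranchTree) (i : ℕ) :
    (t.leaves.filter fun q => q.length = i).card = t.leafCount i := by
  induction t generalizing i with
  | leaf => cases i <;> simp [leaves, leafCount, Finset.filter_singleton]
  | node l r ihl ihr =>
    cases i with
    | zero =>
      simp only [leafCount, Finset.card_eq_zero, Finset.filter_eq_empty_iff]
      intro q hq
      obtain ⟨b, q', -, rfl⟩ := mem_leaves_node.1 hq
      simp
    | succ i =>
      rw [leafCount, ← ihl, ← ihr, leaves, Finset.filter_union, Finset.card_union_of_disjoint]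
      · simp [Finset.filter_image, Finset.card_image_of_injective, List.cons_injective]
      · rw [Finset.disjoint_left]
        simp only [Finset.mem_filter, Finset.mem_image]
        rintro _ ⟨⟨q, -, rfl⟩, -⟩ ⟨⟨q', -, h⟩, -⟩
        simp at h

lemma length_of_mem_leaves {t : BranchTree} {k : ℕ} (ht : ∀ i < k, t.leafCount i = 0)
    {q : List Bool} (hq : q ∈ t.leaves) : k ≤ q.length := by
  by_contra! hlt
  have := ht _ hlt
  rw [← card_leaves_of_length, Finset.card_eq_zero, Finset.filter_eq_empty_iff] at this
  exact this hq rfl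

lemma Bounded.card_le {t : BranchTree} {k d : ℕ} (ht : t.Bounded k d) (v : List Bool) :
    (t.leaves.filter fun q => v <+: q ∧ q.length ≤ v.length + k).card ≤ d := by
  induction t generalizing v with
  | leaf => exact (Finset.card_filter_le _ _).trans ht
  | node l r ihl ihr =>
    obtain ⟨hl, hr, hsum⟩ := ht
    cases v with
    | nil =>
      refine le_trans (le_of_eq ?_) hsum
      rw [Finset.card_eq_sum_card_fiberwise (f := List.length)
        (t := Finset.range (k + 1))]
      · refine Finset.sum_congr rfl fun i hi => ?_
        rw [← card_leaves_of_length, Finset.filter_filter]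
        congr 1
        refine Finset.filter_congr fun q _ => ?_
        have := Finset.mem_range.1 hi
        simp only [List.nil_prefix, true_and, List.length_nil, zero_add]
        lia
      · intro q hq
        simp only [Finset.coe_filter, Set.mem_ofPred_eq, List.length_nil] at hq
        simp only [Finset.coe_range, Set.mem_Iio]
        lia
    | cons b v =>
      have key : ((node l r).leaves.filter fun q =>
          b :: v <+: q ∧ q.length ≤ (b :: v).length + k) =
          (((cond b r l).leaves.filter fun q => v <+: q ∧ q.length ≤ v.length + k)).image
            (List.cons b) := by
        ext q
        simp only [Finset.mem_filter, Finset.mem_image, mem_leaves_node]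
        constructor
        · rintro ⟨⟨b', q', hq', rfl⟩, hpre, hlen⟩
          obtain ⟨rfl, hpre'⟩ := List.cons_prefix_cons.1 hpre
          simp only [List.length_cons] at hlen
          exact ⟨q', ⟨hq', hpre', by lia⟩, rfl⟩
        · rintro ⟨q', ⟨hq', hpre, hlen⟩, rfl⟩
          refine ⟨⟨b, q', hq', rfl⟩, List.cons_prefix_cons.2 ⟨rfl, hpre⟩, ?_⟩
          simp only [List.length_cons]
          lia
      rw [key]
      refine Finset.card_image_le.trans ?_
      cases b
      · exact ihl hl v
      · exact ihr hr v

/-- A set of nodes containing the root and one of any two siblings contains a full branch. -/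
lemma exists_branch_subset (t : BranchTree) (M : Set (List Bool)) (hroot : [] ∈ M)
    (hM : ∀ p b, p ++ [b] ∈ t.nodes → p ++ [!b] ∈ t.nodes → p ++ [b] ∈ M ∨ p ++ [!b] ∈ M) :
    ∃ q ∈ t.leaves, ∀ p, p <+: q → p ∈ M := by
  induction t generalizing M with
  | leaf => exact ⟨[], by simp [leaves], fun p hp => by rwa [List.prefix_nil.1 hp]⟩
  | node l r ihl ihr =>
    have hsub : ∀ b, ∀ p c, p ++ [c] ∈ (cond b r l).nodes → p ++ [!c] ∈ (cond b r l).nodes →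
        p ++ [c] ∈ {p | b :: p ∈ M} ∨ p ++ [!c] ∈ {p | b :: p ∈ M} := fun b p c h h' =>
      hM (b :: p) c (cons_mem_nodes_node h) (cons_mem_nodes_node h')
    have hchild : ∃ b, [b] ∈ M := by
      rcases hM [] false (cons_mem_nodes_node (nil_mem_nodes _))
        (cons_mem_nodes_node (nil_mem_nodes _)) with h | h
      exacts [⟨_, h⟩, ⟨_, h⟩]
    obtain ⟨b, hb⟩ := hchild
    have : ∃ q ∈ (cond b r l).leaves, ∀ p, p <+: q → p ∈ {p | b :: p ∈ M} := by
      cases b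
      · exact ihl _ hb (hsub false)
      · exact ihr _ hb (hsub true)
    obtain ⟨q, hq, hpre⟩ := this
    refine ⟨b :: q, cons_mem_leaves_node.2 hq, fun p hp => ?_⟩
    cases p with
    | nil => exact hroot
    | cons c p =>
      obtain ⟨rfl, hp'⟩ := List.cons_prefix_cons.1 hp
      exact hpre p hp'

end BranchTree

/-! ### The hypergraph of branch ends. -/

/-- The other child of the same parent. -/
def sibling (p : List Bool) : List Bool :=
  match p.getLast? with
  | none => []
  | some b => p.dropLast ++ [!b]

lemma sibling_append_singleton (p : List Bool) (b : Bool) : sibling (p ++ [b]) = p ++ [!b] := by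
  simp [sibling]

lemma sibling_involutive : Function.Involutive sibling := by
  intro p
  induction p using List.reverseRecOn with
  | nil => rfl
  | append_singleton p b _ => simp [sibling_append_singleton]

/-- The last `k + 1` nodes of the branch ending at `q`. -/
def branchEnd (k : ℕ) (q : List Bool) : Set (List Bool) :=
  {p | p <+: q ∧ q.length ≤ p.length + k}

lemma ncard_branchEnd {k : ℕ} {q : List Bool} (hq : k ≤ q.length) :
    (branchEnd k q).ncard = k + 1 := by
  have h : branchEnd k q = (fun i => q.take (q.length - i)) '' (Finset.range (k + 1) : Set ℕ) := by
    ext p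
    simp only [branchEnd, Set.mem_ofPred_eq, Set.mem_image, Finset.coe_range, Set.mem_Iio]
    constructor
    · rintro ⟨hp, hlen⟩
      have := hp.length_le
      exact ⟨q.length - p.length, by lia, by
        rw [Nat.sub_sub_self this]; exact (List.prefix_iff_eq_take.1 hp).symm⟩
    · rintro ⟨i, hi, rfl⟩
      refine ⟨List.take_prefix _ _, ?_⟩
      rw [List.length_take]
      lia
  rw [h, Set.InjOn.ncard_image, Set.ncard_coe_finset, Finset.card_range]
  intro i hi j hj hij
  simp only [Finset.coe_range, Set.mem_Iio] at hi hj
  have := congrArg List.length hij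
  simp only [List.length_take] at this
  lia

/-- The `a`-th petal of a sunflower with kernel `{0, …, k - 1}`. -/
def petal (k a : ℕ) : Set ℕ := {i | i < k ∨ i = k + a}

lemma ncard_petal (k a : ℕ) : (petal k a).ncard = k + 1 := by
  have h : petal k a = (insert (k + a) (Finset.range k) : Finset ℕ) := by
    ext i; simp [petal, or_comm]
  rw [h, Set.ncard_coe_finset, Finset.card_insert_of_notMem (by simp), Finset.card_range]

lemma petal_injective (k : ℕ) : Function.Injective (petal k) := by
  intro a b h
  have : k + a ∈ petal k b := by rw [← h]; exact Or.inr rfl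
  simp only [petal, Set.mem_ofPred_eq] at this
  lia

/-- The ends of the branches of `t`, together with a disjoint sunflower with `d` petals. -/
def branchHypergraph (t : BranchTree) (k d : ℕ) : Hypergraph (List Bool ⊕ ℕ) where
  vertexSet := Sum.inl '' t.nodes ∪ Sum.inr '' Set.Iio (k + d)
  edgeSet := (fun q => Sum.inl '' branchEnd k q) '' t.leaves ∪
    (fun a => Sum.inr '' petal k a) '' Set.Iio d
  subset_vertexSet_of_mem_edgeSet' := by
    rintro e (⟨q, hq, rfl⟩ | ⟨a, ha, rfl⟩)
    · rintro _ ⟨p, hp, rfl⟩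
      exact Or.inl ⟨p, ⟨q, hq, hp.1⟩, rfl⟩
    · rintro _ ⟨i, hi, rfl⟩
      refine Or.inr ⟨i, ?_, rfl⟩
      simp only [petal, Set.mem_ofPred_eq, Set.mem_Iio] at hi ha ⊢
      lia

section BranchHypergraph

variable {t : BranchTree} {k d : ℕ}

lemma finite_vertexSet_branchHypergraph : V(branchHypergraph t k d).Finite :=
  (t.finite_nodes.image _).union ((Set.finite_Iio _).image _)

lemma isUniform_branchHypergraph (ht : ∀ i < k, t.leafCount i = 0) :
    IsUniform (branchHypergraph t k d) (k + 1) := by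
  rintro e (⟨q, hq, rfl⟩ | ⟨a, ha, rfl⟩)
  · dsimp only
    rw [Set.ncard_image_of_injective _ Sum.inl_injective,
      ncard_branchEnd (BranchTree.length_of_mem_leaves ht hq)]
  · dsimp only
    rw [Set.ncard_image_of_injective _ Sum.inr_injective, ncard_petal]

/-- The end of the branch to `q` contains `v` exactly when `q` is a leaf descendant of `v` within
distance `k`. -/
lemma degree_inl_le (ht : t.Bounded k d) (v : List Bool) :
    degree (branchHypergraph t k d) (Sum.inl v) ≤ d := by
  refine le_trans ?_ (ht.card_le v)
  rw [← Set.ncard_coe_finset]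
  refine le_trans (Set.ncard_le_ncard (t := (fun q => Sum.inl '' branchEnd k q) ''
    (t.leaves.filter fun q => v <+: q ∧ q.length ≤ v.length + k : Finset (List Bool))) ?_
    ((Finset.finite_toSet _).image _)) (Set.ncard_image_le (Finset.finite_toSet _))
  rintro e ⟨⟨q, hq, rfl⟩ | ⟨a, ha, rfl⟩, hv⟩
  · obtain ⟨p, hp, hpv⟩ := hv
    obtain rfl := Sum.inl_injective hpv
    refine ⟨q, ?_, rfl⟩
    simp only [Finset.coe_filter, Set.mem_ofPred_eq]
    exact ⟨hq, hp⟩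
  · obtain ⟨i, -, hi⟩ := hv
    cases hi

lemma degree_inr_le (i : ℕ) : degree (branchHypergraph t k d) (Sum.inr i) ≤ d := by
  refine le_trans (Set.ncard_le_ncard (t := (fun a => Sum.inr '' petal k a) '' Set.Iio d) ?_
    ((Set.finite_Iio _).image _)) ((Set.ncard_image_le (Set.finite_Iio _)).trans (by simp))
  rintro e ⟨⟨q, hq, rfl⟩ | he, hv⟩
  · obtain ⟨p, -, hp⟩ := hv
    cases hp
  · exact he

/-- A kernel vertex lies in all `d` petals, so the bound `d` is attained even if no tree node
attains it. -/
lemma degree_inr_zero (hk : 0 < k) : degree (branchHypergraph t k d) (Sum.inr 0) = d := by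
  refine (degree_inr_le 0).antisymm ?_
  have hinj : Function.Injective fun a => (Sum.inr '' petal k a : Set (List Bool ⊕ ℕ)) :=
    (Set.image_injective.2 Sum.inr_injective).comp (petal_injective k)
  calc d = ((fun a => (Sum.inr '' petal k a : Set (List Bool ⊕ ℕ))) '' Set.Iio d).ncard := by
        rw [Set.ncard_image_of_injective _ hinj]; simp
    _ ≤ _ := by
        refine Set.ncard_le_ncard ?_ ?_
        · rintro _ ⟨a, ha, rfl⟩
          exact ⟨Or.inr ⟨a, ha, rfl⟩, 0, Or.inl hk, rfl⟩
        · exact ((t.leaves.finite_toSet.image _).union ((Set.finite_Iio _).image _)).subset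
            fun e he => he.1

lemma hasMaxDegree_branchHypergraph (ht : t.Bounded k d) (hk : 0 < k) :
    HasMaxDegree (branchHypergraph t k d) d := by
  refine ⟨⟨Sum.inr 0, Or.inr ⟨0, by simp [hk], rfl⟩, degree_inr_zero hk⟩, ?_⟩
  rintro _ ⟨v | i, -, rfl⟩
  · exact degree_inl_le ht v
  · exact degree_inr_le i

lemma makerHasWinningStrategy_branchHypergraph :
    MakerHasWinningStrategy (branchHypergraph t k d) := by
  have hnode : ∀ p ∈ t.nodes, Sum.inl p ∈ V(branchHypergraph t k d) := fun p hp =>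
    Or.inl ⟨p, hp, rfl⟩
  refine makerHasWinningStrategy_of_pairing _ (Sum.inl []) (hnode _ t.nil_mem_nodes)
    -- The root and the sunflower vertices are their own partners and hence impose no condition.
    (Sum.map sibling id) ?_ fun M hroot hM => ?_
  · rintro (p | i)
    · simp [sibling_involutive p]
    · rfl
  · obtain ⟨q, hq, hsub⟩ := t.exists_branch_subset {p | Sum.inl p ∈ M} hroot fun p b h h' => by
      have := hM (Sum.inl (p ++ [b])) (hnode _ h)
      rw [Sum.map_inl, sibling_append_singleton] at this
      exact this (hnode _ h') (by simp)
    refine ⟨_, Or.inl ⟨q, hq, rfl⟩, ?_⟩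
    rintro _ ⟨p, hp, rfl⟩
    exact hsub p hp.1

end BranchHypergraph

end MakerBreaker

theorem theorem1p2 :
    ∃ N : ℕ, ∀ n : ℕ, N ≤ n →
      ∃ (V : Type) (H : Hypergraph V),
        V(H).Finite ∧ MakerBreaker.IsUniform H n ∧
          MakerBreaker.HasMaxDegree H (2 ^ (n - 1) / n) ∧
            MakerBreaker.MakerHasWinningStrategy H := by
  refine ⟨6001, fun n hn => ?_⟩
  obtain ⟨k, rfl⟩ := Nat.exists_eq_add_one_of_ne_zero (show n ≠ 0 by lia)
  obtain ⟨t, ht, hcount⟩ := MakerBreaker.constructible_of_large (k := k) (by lia)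
  -- All leaves have depth at least `k`, so every branch is long enough for a hyperedge of `k + 1`
  -- nodes.
  have hcount' : ∀ i < k, t.leafCount i = 0 := fun i hi => by
    simpa [hi.ne] using hcount i hi.le
  exact ⟨_, MakerBreaker.branchHypergraph t k (2 ^ k / (k + 1)),
    MakerBreaker.finite_vertexSet_branchHypergraph,
    MakerBreaker.isUniform_branchHypergraph hcount',
    MakerBreaker.hasMaxDegree_branchHypergraph ht (by lia),
    MakerBreaker.makerHasWinningStrategy_branchHypergraph⟩
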